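/- **Setting.** Let $1\le m\le n$ and let $\Omega\subset\mathbb R^n$ be a bounded domain. For a symmetric $n\times n$ matrix $S$ let $T_p(S)$ be the sum of all principal $p$-minors of $S$, with $T_0(S)=1$; $S$ is called $m$-positive if $T_p(S)>0$ for $p=1,\dots,m$. For $u=u(x,t)$ put $$E_m[u]=-u_t\,T_{m-1}(u_{xx})+T_m(u_{xx}),$$ where $u_{xx}$ is the Hesse matrix of $u$ in $x$. Let $\mathbf u\in C^2(\Omega)\cap C(\bar\Omega)$ be an $m$-admissible solution of $T_m(\mathbf u_{xx})=\mathbf f$ in $\Omega$, $\mathbf u|_{\partial\Omega}=\Phi$; that is, $\mathbf u_{xx}(x)$ is $m$-positive for every $x\in\Omega$. Assume that there are constants $\nu_m,\mu_{m-1},\mu_m$ with $0<\nu_m\le\mathbf f$, $T_{m-1}(\mathbf u_{xx})\le\mu_{m-1}$ and $T_m(\mathbf u_{xx})\le\mu_m$ in $\Omega$. **Theorem 5.3.** Let $Q=\Omega\times[0,\infty)$, $\bar Q=\bar\Omega\times[0,\infty)$ and $u\in C^{2,1}(Q)\cap C(\bar Q)$ (at $t=0$ the derivative $u_t$ is one-sided).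 Assume that there is a point $(x_0,t_0)\in Q$ such that $u_{xx}(x_0,t_0)$ is $m$-positive, and that $0<\nu\le E_m[u]\le\mu$ in $Q_0=\Omega\times[t_0,\infty)$ for some constants $\nu,\mu$. Let $\partial'Q_0=(\Omega\times\{t_0\})\cup(\partial\Omega\times[t_0,\infty))$. Assume that there are positive non-increasing functions $h_1^+,h_2^+,h^-$ on $[t_0,\infty)$ such that $$u(x,t)-\mathbf u(x)\le h_1^+(t)\ \text{ on }\partial'Q_0,\qquad \frac1m\Big(1-\frac{E_m[u](x,t)}{\mathbf f(x)}\Big)\le h_2^+(t)\ \text{ in }Q_0,\tag{ub}$$ $$u(x,t)-\mathbf u(x)\ge -h^-(t)\ \text{ on }\partial'Q_0,\qquad \frac1m\Big(1-\frac{E_m[u](x,t)}{\mathbf f(x)}\Big)\ge -h^-(t)\ \text{ in }Q_0.\tag{lb}$$ (On $\partial\Omega$ one has $\mathbf u=\Phi$.) Then $u$ is bounded on $Q$: there is a constant $C$ with $|u(x,t)|\le C$ for all $(x,t)\in Q$. If in addition $\lim_{t\to\infty}\max\{h^+(t),h^-(t)\}=0$, where $h^+=\max\{h_1^+,h_2^+\}$,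 then $\mathbf u$ attracts $u$ in $C(\bar Q)$: $$\lim_{t\to\infty}\ \sup_{x\in\bar\Omega}|u(x,t)-\mathbf u(x)|=0 .$$ -/

import Mathlib

open Set Filter Topology

namespace MHessian

/-- The `p`-trace `T_p(S)`: the sum of all principal `p`-minors of `S` (so `T_0(S) = 1`). -/
noncomputable def pTrace {n : ℕ} (p : ℕ) (S : Matrix (Fin n) (Fin n) ℝ) : ℝ :=
  ∑ I ∈ (Finset.univ : Finset (Fin n)).powersetCard p,
    (S.submatrix (fun i : I => (i : Fin n)) (fun i : I => (i : Fin n))).det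

/-- `S` is `m`-positive: it is symmetric and `T_p(S) > 0` for `p = 1, …, m`. -/
def IsMPositive {n : ℕ} (m : ℕ) (S : Matrix (Fin n) (Fin n) ℝ) : Prop :=
  S.IsSymm ∧ ∀ p : ℕ, 1 ≤ p → p ≤ m → 0 < pTrace p S

/-- The partial derivative `∂_i g` of a function on `ℝⁿ`. -/
noncomputable def partialDeriv {n : ℕ} (i : Fin n) (g : EuclideanSpace ℝ (Fin n) → ℝ)
    (x : EuclideanSpace ℝ (Fin n)) : ℝ :=
  fderiv ℝ g x (EuclideanSpace.single i 1)

/-- The Hesse matrix `g_xx = (∂_i ∂_j g)`. -/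
noncomputable def hessian {n : ℕ} (g : EuclideanSpace ℝ (Fin n) → ℝ)
    (x : EuclideanSpace ℝ (Fin n)) : Matrix (Fin n) (Fin n) ℝ :=
  Matrix.of fun i j => partialDeriv i (partialDeriv j g) x

/-- The time derivative `u_t` on `t ≥ 0`: the usual derivative for `t > 0`, the right derivative
at `t = 0`. -/
noncomputable def timeDeriv {n : ℕ} (u : EuclideanSpace ℝ (Fin n) → ℝ → ℝ)
    (x : EuclideanSpace ℝ (Fin n)) (t : ℝ) : ℝ :=
  derivWithin (u x) (Ici 0) t

/-- The `m`-Hessian evolution operator `E_m[u] = -u_t T_{m-1}(u_xx) + T_m(u_xx)`, for `m ≥ 1`. -/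
noncomputable def evolOp {n : ℕ} (m : ℕ) (u : EuclideanSpace ℝ (Fin n) → ℝ → ℝ)
    (x : EuclideanSpace ℝ (Fin n)) (t : ℝ) : ℝ :=
  -timeDeriv u x t * pTrace (m - 1) (hessian (fun y => u y t) x)
    + pTrace m (hessian (fun y => u y t) x)

/-- `u ∈ C^{2,1}(Q)`, `Q = Ω × [0, ∞)`, for an open set `Ω`: the derivatives `u_x`, `u_xx`, `u_t`
exist and, together with `u`, are continuous on `Q`. -/
structure IsC21 {n : ℕ} (Ω : Set (EuclideanSpace ℝ (Fin n)))
    (u : EuclideanSpace ℝ (Fin n) → ℝ → ℝ) : Prop where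
  contDiffOn_space : ∀ t : ℝ, 0 ≤ t → ContDiffOn ℝ 2 (fun x => u x t) Ω
  differentiableOn_time : ∀ x ∈ Ω, DifferentiableOn ℝ (u x) (Ici 0)
  continuousOn : ContinuousOn (fun z : EuclideanSpace ℝ (Fin n) × ℝ => u z.1 z.2) (Ω ×ˢ Ici 0)
  continuousOn_grad : ∀ i : Fin n,
    ContinuousOn (fun z : EuclideanSpace ℝ (Fin n) × ℝ => partialDeriv i (fun y => u y z.2) z.1)
      (Ω ×ˢ Ici 0)
  continuousOn_hessian : ∀ i j : Fin n,
    ContinuousOn (fun z : EuclideanSpace ℝ (Fin n) × ℝ => hessian (fun y => u y z.2) z.1 i j)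
      (Ω ×ˢ Ici 0)
  continuousOn_timeDeriv :
    ContinuousOn (fun z : EuclideanSpace ℝ (Fin n) × ℝ => timeDeriv u z.1 z.2) (Ω ×ˢ Ici 0)

/-- `v ∈ C²(Ω) ∩ C(Ω̄)` is an `m`-admissible solution of the Dirichlet problem
`T_m[v] = f` in `Ω`, `v = Φ` on `∂Ω`. -/
structure IsStationarySolution {n : ℕ} (m : ℕ) (Ω : Set (EuclideanSpace ℝ (Fin n)))
    (f Φ v : EuclideanSpace ℝ (Fin n) → ℝ) : Prop where
  contDiffOn : ContDiffOn ℝ 2 v Ω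
  continuousOn : ContinuousOn v (closure Ω)
  admissible : ∀ x ∈ Ω, IsMPositive m (hessian v x)
  equation : ∀ x ∈ Ω, pTrace m (hessian v x) = f x
  boundary : ∀ x ∈ frontier Ω, v x = Φ x

/-- The parabolic boundary `(Ω × {t₀}) ∪ (∂Ω × [t₀, ∞))` of `Q₀ = Ω × [t₀, ∞)`. -/
def parabolicBoundary {n : ℕ} (Ω : Set (EuclideanSpace ℝ (Fin n))) (t₀ : ℝ) :
    Set (EuclideanSpace ℝ (Fin n) × ℝ) :=
  (Ω ×ˢ {t₀}) ∪ (frontier Ω ×ˢ Ici t₀)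

end MHessian

namespace MHessian

open Polynomial Matrix

/-! The starting point is that `E_m[u]` is the `m`-trace of the block matrix `diag(-u_t, u_xx)`,
i.e. a coefficient of the real-rooted polynomial `(1 + sX) det(1 + XS)` with `s = -u_t`, `S = u_xx`.
Newton's inequalities for such polynomials give two facts: traces are monotone on the cone where
those up to order `m` are positive (`blockTrace_mono`), and a point of the closed cone with positive
`m`-trace lies inside it (`blockTrace_pos_of_nonneg`). By connectedness, the second fact spreads
`m`-positivity from one point to all of `Q₀`.

Monotonicity and the maximum principle then compare `u` with barriers `a v + c ∓ ηt`. Constants from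
above and `A v - const` with large `A` from below bound `u`. For convergence, each late time `T`
gets its own pair `(1 ∓ δ) v ± (ε + δV + η(T - t))`: at the initial time `η(T - t₁)` absorbs
whatever discrepancy there is, and at `t = T` it has vanished, leaving an error below the prescribed
`e`. -/

/-! ### Real-rooted polynomials and Newton's inequalities. -/

/-- For `p = (X - a) q` one has `p'² - p p'' = q² + (x - a)² (q'² - q q'')`, so the inequality
passes from `q` to `p`. -/
theorem laguerre_of_multiset (s : Multiset ℝ) (x : ℝ) :
    let p : ℝ[X] := (s.map fun a => X - C a).prod
    p.eval x * p.derivative.derivative.eval x ≤ p.derivative.eval x ^ 2 := by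
  induction s using Multiset.induction_on with
  | empty => simp
  | cons a s ih =>
    simp only [Multiset.map_cons, Multiset.prod_cons] at ih ⊢
    set q : ℝ[X] := (s.map fun a => X - C a).prod
    simp only [derivative_mul, derivative_sub, derivative_X, derivative_C, derivative_add,
      eval_mul, eval_add, eval_sub, eval_X, eval_C, eval_one, derivative_one, eval_zero,
      derivative_zero]
    nlinarith [sq_nonneg (q.eval x), mul_le_mul_of_nonneg_left ih (sq_nonneg (x - a))]

theorem laguerre_of_splits {p : ℝ[X]} (hp : p.Splits) (x : ℝ) :
    p.eval x * p.derivative.derivative.eval x ≤ p.derivative.eval x ^ 2 := by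
  have h := laguerre_of_multiset p.roots x
  rw [hp.eq_prod_roots]
  simp only [derivative_C_mul, eval_mul, eval_C] at h ⊢
  nlinarith [mul_le_mul_of_nonneg_left h (sq_nonneg p.leadingCoeff)]

/-- A root `a` would give `p = c (X - a) q`, and the Laguerre identity would make `p'² - p p''` at
least `c² q(x)² > 0`. -/
theorem natDegree_eq_zero_of_splits {p : ℝ[X]} (hp : p.Splits) (x : ℝ) (h0 : p.eval x ≠ 0)
    (h1 : p.derivative.eval x = 0) (h2 : p.derivative.derivative.eval x = 0) :
    p.natDegree = 0 := by
  rw [hp.natDegree_eq_card_roots, Multiset.card_eq_zero]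
  by_contra hne
  obtain ⟨a, ha⟩ := Multiset.exists_mem_of_ne_zero hne
  obtain ⟨s, hs⟩ := Multiset.exists_cons_of_mem ha
  have hlag := laguerre_of_multiset s x
  rw [hp.eq_prod_roots, hs] at h0 h1 h2
  simp only [Multiset.map_cons, Multiset.prod_cons] at h0 h1 h2 hlag
  set q : ℝ[X] := (s.map fun a => X - C a).prod
  simp only [derivative_mul, derivative_sub, derivative_X, derivative_C, derivative_add,
    eval_mul, eval_add, eval_sub, eval_X, eval_C,
    zero_mul, zero_add, sub_zero, one_mul] at h0 h1 h2
  have hc := left_ne_zero_of_mul h0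
  have hq := right_ne_zero_of_mul (right_ne_zero_of_mul h0)
  have h1' := (mul_eq_zero.1 h1).resolve_left hc
  have h2' := (mul_eq_zero.1 h2).resolve_left hc
  have hq2 : 0 < q.eval x ^ 2 := by positivity
  have e : q.eval x ^ 2 + (x - a) ^ 2 *
      (q.derivative.eval x ^ 2 - q.eval x * q.derivative.derivative.eval x) = 0 := by
    linear_combination (eval x q + (x - a) * eval x (derivative q)) * h1' -
      (x - a) * eval x q * h2'
  nlinarith [mul_nonneg (sq_nonneg (x - a)) (sub_nonneg.2 hlag)]

/-- By Rolle, differentiation loses at most one root counted with multiplicity. -/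
theorem splits_derivative {p : ℝ[X]} (hp : p.Splits) : p.derivative.Splits := by
  rw [splits_iff_card_roots] at hp ⊢
  have h1 := card_roots_le_derivative p
  have h2 := card_roots' p.derivative
  have h3 := natDegree_derivative_le p
  rcases Nat.eq_zero_or_pos p.natDegree with h0 | h0
  · have : p.derivative = 0 := by
      rw [eq_C_of_natDegree_eq_zero h0]; simp
    simp [this]
  · omega

theorem splits_iterate_derivative {p : ℝ[X]} (hp : p.Splits) (k : ℕ) :
    (derivative^[k] p).Splits := by
  induction k with
  | zero => exact hp
  | succ k ih => rw [Function.iterate_succ_apply']; exact splits_derivative ih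

/-- Laguerre's inequality at `0` for the `k`-th derivative gives the sharper `(k + 2) a_k a_{k+2} ≤
(k + 1) a_{k+1}²`; constant `1` suffices below. -/
theorem coeff_mul_coeff_le_sq {p : ℝ[X]} (hp : p.Splits) (k : ℕ) :
    p.coeff k * p.coeff (k + 2) ≤ p.coeff (k + 1) ^ 2 := by
  have h := laguerre_of_splits (splits_iterate_derivative hp k) 0
  rw [← Function.iterate_succ_apply' derivative, ← Function.iterate_succ_apply' derivative] at h
  simp only [← coeff_zero_eq_eval_zero, coeff_iterate_derivative, zero_add, Nat.descFactorial_self,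
    nsmul_eq_mul] at h
  rw [Nat.factorial_succ, Nat.factorial_succ] at h
  push_cast at h
  have hf : (0 : ℝ) < k.factorial := by exact_mod_cast k.factorial_pos
  have hk : (0 : ℝ) ≤ k := Nat.cast_nonneg k
  have h' : (k.factorial : ℝ) ^ 2 * ((k + 1) * ((k + 2) * (p.coeff k * p.coeff (k + 2)))) ≤
      (k.factorial : ℝ) ^ 2 * ((k + 1) * ((k + 1) * p.coeff (k + 1) ^ 2)) := by
    nlinarith [h]
  have h2 := le_of_mul_le_mul_left (le_of_mul_le_mul_left h' (by positivity)) (by positivity)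
  by_cases hc : p.coeff k * p.coeff (k + 2) ≤ 0
  · exact hc.trans (sq_nonneg _)
  · push Not at hc
    refine le_of_mul_le_mul_left (a := (k : ℝ) + 1) ?_ (by positivity)
    nlinarith

theorem coeff_eq_zero_of_consecutive {p : ℝ[X]} (hp : p.Splits) {k : ℕ} (h0 : p.coeff k ≠ 0)
    (h1 : p.coeff (k + 1) = 0) (h2 : p.coeff (k + 2) = 0) {j : ℕ} (hj : k < j) :
    p.coeff j = 0 := by
  have hdeg : (derivative^[k] p).natDegree = 0 := by
    refine natDegree_eq_zero_of_splits (splits_iterate_derivative hp k) 0 ?_ ?_ ?_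
    · rw [← coeff_zero_eq_eval_zero, coeff_iterate_derivative, zero_add, Nat.descFactorial_self,
        nsmul_eq_mul]
      exact mul_ne_zero (by exact_mod_cast k.factorial_ne_zero) h0
    · rw [← Function.iterate_succ_apply' derivative, ← coeff_zero_eq_eval_zero,
        coeff_iterate_derivative, zero_add, h1, smul_zero]
    · rw [← Function.iterate_succ_apply' derivative, ← Function.iterate_succ_apply' derivative,
        ← coeff_zero_eq_eval_zero, coeff_iterate_derivative, zero_add, h2, smul_zero]
  have h := coeff_eq_zero_of_natDegree_lt (p := derivative^[k] p) (n := j - k) (by omega)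
  rw [coeff_iterate_derivative, Nat.sub_add_cancel hj.le, nsmul_eq_mul] at h
  refine (mul_eq_zero.1 h).resolve_left ?_
  exact_mod_cast (Nat.descFactorial_eq_zero_iff_lt.not.2 (by omega))

theorem coeff_linear_mul_zero (r : ℝ) (q : ℝ[X]) :
    ((1 + C r * X) * q).coeff 0 = q.coeff 0 := by
  simp [add_mul, mul_assoc]

theorem coeff_linear_mul_succ (r : ℝ) (q : ℝ[X]) (k : ℕ) :
    ((1 + C r * X) * q).coeff (k + 1) = q.coeff (k + 1) + r * q.coeff k := by
  simp [add_mul, mul_assoc]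

theorem splits_linear (r : ℝ) : (1 + C r * X : ℝ[X]).Splits := by
  apply Splits.of_natDegree_le_one
  compute_degree

/-- Removing a linear factor from a real-rooted polynomial with positive coefficients up to
order `m` leaves positive coefficients up to order `m - 1`. -/
theorem coeff_pos_of_linear_mul {q : ℝ[X]} (hq : q.Splits) (r : ℝ) (m : ℕ)
    (h : ∀ k ≤ m, 0 < ((1 + C r * X) * q).coeff k) : ∀ k < m, 0 < q.coeff k := by
  intro k
  induction k with
  | zero =>
    intro _
    have := h 0 (Nat.zero_le _)
    rwa [coeff_linear_mul_zero] at this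
  | succ k ih =>
    intro hk
    have hb := ih (by omega)
    have h1 := h (k + 1) (by omega)
    have h2 := h (k + 2) (by omega)
    rw [coeff_linear_mul_succ] at h1 h2
    have hN := coeff_mul_coeff_le_sq hq k
    -- If `q_{k+1} ≤ 0`, then `q_k (q_{k+2} + r q_{k+1}) > 0` and `-q_{k+1} (q_{k+1} + r q_k) ≥ 0`
    -- add up to `q_k q_{k+2} > q_{k+1}²`, against Newton.
    by_contra hneg
    push Not at hneg
    have hr : 0 < r := by
      by_contra hr
      push Not at hr
      nlinarith
    have h3 : 0 < q.coeff (k + 2) := by nlinarith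
    nlinarith [mul_pos h2 hb, mul_nonneg (neg_nonneg.2 hneg) h1.le]

/-! ### Traces of block matrices and the positivity cone. -/

theorem det_diagonal_add_smul_vecMulVec {ι : Type*} [Fintype ι] [DecidableEq ι] (d w : ι → ℝ)
    (c : ℝ) (hd : ∀ i, d i ≠ 0) :
    (diagonal d + c • vecMulVec w w).det =
      ∏ i, d i + c * ∑ i, w i ^ 2 * ∏ j ∈ Finset.univ.erase i, d j := by
  have hdet : (diagonal d).det = ∏ i, d i := det_diagonal
  have hu : IsUnit (diagonal d).det := by
    rw [hdet]; exact (Finset.prod_ne_zero_iff.2 fun i _ => hd i).isUnit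
  have hinv : (diagonal d)⁻¹ = diagonal (fun i => (d i)⁻¹) := by
    apply inv_eq_right_inv
    rw [diagonal_mul_diagonal, ← diagonal_one]
    congr 1; ext i; exact mul_inv_cancel₀ (hd i)
  have h := det_add_replicateCol_mul_replicateRow (ι := Unit) hu (c • w) w
  rw [show replicateCol Unit (c • w) * replicateRow Unit w = c • vecMulVec w w by
    ext i j; simp [Matrix.mul_apply, vecMulVec_apply, mul_assoc]] at h
  rw [h, hdet, hinv, det_unique]
  simp only [Matrix.add_apply, Matrix.one_apply_eq, Matrix.mul_apply, replicateRow_apply,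
    replicateCol_apply, diagonal_apply, mul_ite, mul_zero, Finset.sum_ite_eq', Finset.mem_univ,
    if_true, Pi.smul_apply, smul_eq_mul, mul_add, mul_one, Finset.mul_sum]
  congr 1
  refine Finset.sum_congr rfl fun i _ => ?_
  rw [← Finset.mul_prod_erase _ _ (Finset.mem_univ i)]
  field_simp [hd i]

/-- The generating polynomial `det (1 + X S) = ∑ T_k(S) X ^ k` of the traces of `S`. -/
noncomputable def gen {n : ℕ} (S : Matrix (Fin n) (Fin n) ℝ) : ℝ[X] :=
  det (1 + (X : ℝ[X]) • S.map C)

theorem coeff_gen {n : ℕ} (S : Matrix (Fin n) (Fin n) ℝ) (k : ℕ) :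
    (gen S).coeff k = pTrace k S :=
  coeff_det_one_add_X_smul_eq_sum_minors S k

theorem eval_gen {n : ℕ} (S : Matrix (Fin n) (Fin n) ℝ) (x : ℝ) :
    (gen S).eval x = det (1 + x • S) := by
  rw [gen, ← coe_evalRingHom, RingHom.map_det]
  congr 1
  ext i j
  by_cases hij : i = j <;> simp [hij, mul_comm x]

theorem exists_orthogonal_diagonalization {n : ℕ} {S : Matrix (Fin n) (Fin n) ℝ}
    (hS : S.IsSymm) : ∃ (U : Matrix (Fin n) (Fin n) ℝ) (d : Fin n → ℝ),
      U * Uᵀ = 1 ∧ S = U * diagonal d * Uᵀ := by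
  have hH : S.IsHermitian := by
    rw [Matrix.IsHermitian, conjTranspose_eq_transpose_of_trivial]; exact hS
  refine ⟨hH.eigenvectorUnitary, hH.eigenvalues, ?_, ?_⟩
  · have := Unitary.coe_mul_star_self hH.eigenvectorUnitary
    rwa [Unitary.coe_star, star_eq_conjTranspose, conjTranspose_eq_transpose_of_trivial] at this
  · have := hH.spectral_theorem
    rw [Unitary.conjStarAlgAut_apply, star_eq_conjTranspose,
      conjTranspose_eq_transpose_of_trivial] at this
    exact this

/-- In the eigenbasis this is the matrix determinant lemma, valid at every `x` with all `1 + x d_i ≠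
0`; infinitely many points determine the polynomial. -/
theorem gen_add_vecMulVec {n : ℕ} {U : Matrix (Fin n) (Fin n) ℝ} {d : Fin n → ℝ}
    (hU : U * Uᵀ = 1) (w : Fin n → ℝ) :
    gen (U * diagonal d * Uᵀ + vecMulVec (U *ᵥ w) (U *ᵥ w)) =
      ∏ i, (1 + C (d i) * X) +
        X * ∑ i, C (w i ^ 2) * ∏ j ∈ Finset.univ.erase i, (1 + C (d j) * X) := by
  have hne : (∏ i, (1 + C (d i) * X) : ℝ[X]) ≠ 0 := by
    refine Finset.prod_ne_zero_iff.2 fun i _ h => ?_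
    have := congrArg (coeff · 0) h
    simp at this
  refine eq_of_infinite_eval_eq _ _ (Set.Infinite.mono ?_
    (Set.Finite.infinite_compl (finite_setOfPred_isRoot hne)))
  intro x hx
  have hx' : ∀ i, 1 + x * d i ≠ 0 := by
    have : ¬ IsRoot (∏ i, (1 + C (d i) * X) : ℝ[X]) x := hx
    rw [IsRoot.def, eval_prod] at this
    intro i
    have := Finset.prod_ne_zero_iff.1 this i (Finset.mem_univ i)
    simpa only [eval_add, eval_mul, eval_one, eval_C, eval_X, mul_comm x] using this
  have hM : 1 + x • (U * diagonal d * Uᵀ + vecMulVec (U *ᵥ w) (U *ᵥ w)) =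
      U * (diagonal (fun i => 1 + x * d i) + x • vecMulVec w w) * Uᵀ := by
    have h1 : (diagonal (fun i => 1 + x * d i) : Matrix (Fin n) (Fin n) ℝ) =
        1 + x • diagonal d := by
      ext i j; by_cases hij : i = j <;> simp [hij]
    have h2 : vecMulVec (U *ᵥ w) (U *ᵥ w) = U * vecMulVec w w * Uᵀ := by
      rw [mul_vecMulVec, vecMulVec_mul, vecMul_transpose]
    rw [h1, h2]
    simp only [Matrix.mul_add, Matrix.add_mul, Matrix.mul_smul, Matrix.smul_mul, Matrix.mul_one,
      hU, smul_add, add_assoc]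
  have hdet : U.det * Uᵀ.det = 1 := by rw [← det_mul, hU, det_one]
  show eval x _ = eval x _
  rw [eval_gen, hM, det_mul, det_mul, mul_right_comm, hdet, one_mul,
    det_diagonal_add_smul_vecMulVec _ _ _ hx']
  simp only [eval_finsetSum, eval_prod, eval_add, eval_mul, eval_one, eval_C, eval_X, mul_comm x]

theorem gen_conj_diagonal {n : ℕ} {U : Matrix (Fin n) (Fin n) ℝ} {d : Fin n → ℝ}
    (hU : U * Uᵀ = 1) : gen (U * diagonal d * Uᵀ) = ∏ i, (1 + C (d i) * X) := by
  have := gen_add_vecMulVec (d := d) hU 0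
  simpa using this

theorem splits_gen {n : ℕ} {S : Matrix (Fin n) (Fin n) ℝ} (hS : S.IsSymm) :
    (gen S).Splits := by
  obtain ⟨U, d, hU, rfl⟩ := exists_orthogonal_diagonalization hS
  rw [gen_conj_diagonal hU]
  exact Splits.prod fun i _ => splits_linear _

/-- The `k`-trace of the block diagonal matrix `diag(s, S)`. -/
noncomputable def blockTrace {n : ℕ} (s : ℝ) (S : Matrix (Fin n) (Fin n) ℝ) (k : ℕ) : ℝ :=
  ((1 + C s * X) * gen S).coeff k

theorem pTrace_zero {n : ℕ} (S : Matrix (Fin n) (Fin n) ℝ) : pTrace 0 S = 1 := by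
  simp [pTrace]

theorem blockTrace_zero {n : ℕ} (s : ℝ) (S : Matrix (Fin n) (Fin n) ℝ) :
    blockTrace s S 0 = 1 := by
  rw [blockTrace, coeff_linear_mul_zero, coeff_gen, pTrace_zero]

theorem blockTrace_succ {n : ℕ} (s : ℝ) (S : Matrix (Fin n) (Fin n) ℝ) (k : ℕ) :
    blockTrace s S (k + 1) = s * pTrace k S + pTrace (k + 1) S := by
  rw [blockTrace, coeff_linear_mul_succ, coeff_gen, coeff_gen, add_comm]

theorem blockTrace_newton {n : ℕ} (s : ℝ) {S : Matrix (Fin n) (Fin n) ℝ} (hS : S.IsSymm)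
    (k : ℕ) : blockTrace s S k * blockTrace s S (k + 2) ≤ blockTrace s S (k + 1) ^ 2 :=
  coeff_mul_coeff_le_sq ((splits_linear s).mul (splits_gen hS)) k

theorem blockTrace_le_of_le {n m : ℕ} {s s' : ℝ} (hs : s ≤ s') {S : Matrix (Fin n) (Fin n) ℝ}
    (hS : S.IsSymm) (h : ∀ k ≤ m, 0 < blockTrace s S k) :
    ∀ k ≤ m, blockTrace s S k ≤ blockTrace s' S k := by
  have hpos := coeff_pos_of_linear_mul (splits_gen hS) s m h
  rintro (_ | k) hk
  · rw [blockTrace_zero, blockTrace_zero]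
  · have := hpos k (by omega)
    rw [coeff_gen] at this
    rw [blockTrace_succ, blockTrace_succ]
    nlinarith

/-- The increment is a combination, with weights `w'_i²`, of coefficients of the product with the
factor `1 + d_i X` deleted, and deleting a linear factor keeps positivity one order lower. -/
theorem blockTrace_le_add_vecMulVec {n m : ℕ} {s : ℝ} {S : Matrix (Fin n) (Fin n) ℝ}
    (hS : S.IsSymm) (w : Fin n → ℝ) (h : ∀ k ≤ m, 0 < blockTrace s S k) :
    ∀ k ≤ m, blockTrace s S k ≤ blockTrace s (S + vecMulVec w w) k := by
  obtain ⟨U, d, hU, rfl⟩ := exists_orthogonal_diagonalization hS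
  have hw : w = U *ᵥ (Uᵀ *ᵥ w) := by rw [mulVec_mulVec, hU, one_mulVec]
  rw [hw]
  set w' := Uᵀ *ᵥ w
  have hsp : ∀ i : Fin n, ((1 + C s * X) *
      ∏ j ∈ Finset.univ.erase i, (1 + C (d j) * X) : ℝ[X]).Splits := fun i =>
    (splits_linear s).mul (Splits.prod fun j _ => splits_linear _)
  have hpos : ∀ i : Fin n, ∀ k < m, 0 < ((1 + C s * X) *
      ∏ j ∈ Finset.univ.erase i, (1 + C (d j) * X) : ℝ[X]).coeff k := by
    intro i
    refine coeff_pos_of_linear_mul (hsp i) (d i) m fun k hk => ?_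
    have := h k hk
    rwa [blockTrace, gen_conj_diagonal hU, ← Finset.mul_prod_erase _ _ (Finset.mem_univ i),
      mul_left_comm] at this
  have key : (1 + C s * X) * gen (U * diagonal d * Uᵀ + vecMulVec (U *ᵥ w') (U *ᵥ w')) =
      (1 + C s * X) * gen (U * diagonal d * Uᵀ) +
        X * ∑ i, C (w' i ^ 2) * ((1 + C s * X) *
          ∏ j ∈ Finset.univ.erase i, (1 + C (d j) * X)) := by
    rw [gen_add_vecMulVec hU, gen_conj_diagonal hU, mul_add]
    congr 1
    rw [mul_left_comm, Finset.mul_sum]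
    simp only [mul_left_comm]
  rintro (_ | k) hk
  · rw [blockTrace_zero, blockTrace_zero]
  · rw [blockTrace, blockTrace, key, coeff_add, coeff_X_mul, finsetSum_coeff]
    simp only [coeff_C_mul]
    exact le_add_of_nonneg_right (Finset.sum_nonneg fun i _ =>
      mul_nonneg (sq_nonneg _) (hpos i k (by omega)).le)

theorem isSymm_vecMulVec_self {n : ℕ} (w : Fin n → ℝ) : (vecMulVec w w).IsSymm := by
  ext i j; simp [vecMulVec_apply, mul_comm]

/-- Monotonicity of the traces on the cone of `m`-positive matrices `diag(s, S)`. -/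
theorem blockTrace_mono {n m : ℕ} {s s' : ℝ} (hs : s ≤ s') {S S' : Matrix (Fin n) (Fin n) ℝ}
    (hS : S.IsSymm) (hSS' : (S' - S).PosSemidef) (h : ∀ k ≤ m, 0 < blockTrace s S k) :
    ∀ k ≤ m, blockTrace s S k ≤ blockTrace s' S' k := by
  obtain ⟨B, hB⟩ : ∃ B : Matrix (Fin n) (Fin n) ℝ, S' - S = Bᴴ * B := by
    open scoped MatrixOrder in
    obtain ⟨B, hB⟩ := CStarAlgebra.nonneg_iff_eq_star_mul_self.1 hSS'.nonneg
    exact ⟨B, hB⟩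
  -- The rows of `B` split `S' - S` into rank-one terms. Adding them one at a time only increases
  -- the traces, so the cone is never left.
  have hsum : S' = S + ∑ i, vecMulVec (B i) (B i) := by
    rw [← sub_eq_iff_eq_add', hB]
    ext i j
    simp [Matrix.mul_apply, Matrix.sum_apply, vecMulVec_apply]
  have key : ∀ t : Finset (Fin n), (S + ∑ i ∈ t, vecMulVec (B i) (B i)).IsSymm ∧
      ∀ k ≤ m, blockTrace s S k ≤ blockTrace s (S + ∑ i ∈ t, vecMulVec (B i) (B i)) k := by
    intro t
    induction t using Finset.induction_on with
    | empty => simpa using hS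
    | insert a t ha ih =>
      rw [Finset.sum_insert ha, add_comm (vecMulVec _ _), ← add_assoc]
      refine ⟨ih.1.add (isSymm_vecMulVec_self _), fun k hk => (ih.2 k hk).trans ?_⟩
      exact blockTrace_le_add_vecMulVec ih.1 _ (fun k hk => (h k hk).trans_le (ih.2 k hk)) k hk
  obtain ⟨hS', hle⟩ := key Finset.univ
  rw [← hsum] at hS' hle
  exact fun k hk => (hle k hk).trans
    (blockTrace_le_of_le hs hS' (fun k hk => (h k hk).trans_le (hle k hk)) k hk)

/-- `diag(s, S)` is `m`-positive as soon as `S` is and `T_m(diag(s, S)) > 0`. -/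
theorem blockTrace_pos_of_isMPositive {n m : ℕ} {s : ℝ} {S : Matrix (Fin n) (Fin n) ℝ}
    (hS : IsMPositive m S) (h : 0 < blockTrace s S m) : ∀ k ≤ m, 0 < blockTrace s S k := by
  have hT : ∀ k ≤ m, 0 < pTrace k S := by
    rintro (_ | k) hk
    · rw [pTrace_zero]; exact one_pos
    · exact hS.2 _ (by omega) hk
  refine fun k hk => Nat.decreasingInduction (motive := fun k _ => 0 < blockTrace s S k)
    ?_ h hk
  rintro (_ | k) hk ih
  · rw [blockTrace_zero]; exact one_pos
  · rw [blockTrace_succ] at ih ⊢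
    have hN := coeff_mul_coeff_le_sq (splits_gen hS.1) k
    simp only [coeff_gen] at hN
    have h0 := hT k (by omega)
    have h1 := hT (k + 1) (by omega)
    -- Same combination as in `coeff_pos_of_linear_mul`: it would yield `T_k T_{k+2} > T_{k+1}²` for
    -- `S`.
    by_contra hneg
    push Not at hneg
    nlinarith [mul_pos ih h0, mul_nonneg (neg_nonneg.2 hneg) h1.le]

/-- In the closure of the cone, positivity of the highest trace forces positivity of all. -/
theorem blockTrace_pos_of_nonneg {n m : ℕ} {s : ℝ} {S : Matrix (Fin n) (Fin n) ℝ}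
    (hS : S.IsSymm) (h : ∀ k ≤ m, 0 ≤ blockTrace s S k) (hm : 0 < blockTrace s S m) :
    ∀ k ≤ m, 0 < blockTrace s S k := by
  have hpos : ∀ k, ∀ j ≤ k, j ≤ m → 0 < blockTrace s S j := by
    intro k
    induction k with
    | zero =>
      intro j hj _
      rw [Nat.le_zero.1 hj, blockTrace_zero]
      exact one_pos
    | succ k ih =>
      intro j hj hjm
      rcases Nat.lt_or_ge j (k + 1) with hlt | hge
      · exact ih j (by omega) hjm
      obtain rfl : j = k + 1 := le_antisymm hj hge
      -- At a first vanishing trace, Newton forces the next one to vanish too; two consecutive zeros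
      -- annihilate all later coefficients, including the `m`-th.
      refine lt_of_le_of_ne (h _ hjm) fun h0 => ?_
      have hk := ih k le_rfl (by omega)
      have hne : k + 1 ≠ m := fun e => by rw [← e, ← h0] at hm; exact lt_irrefl _ hm
      have hN := blockTrace_newton s hS k
      have h2 := h (k + 2) (by omega)
      have h2' : blockTrace s S (k + 2) = 0 := by
        rw [← h0] at hN
        nlinarith
      exact hm.ne' (coeff_eq_zero_of_consecutive ((splits_linear s).mul (splits_gen hS))
        hk.ne' h0.symm h2' (by omega))
  exact fun k hk => hpos k k le_rfl hk

end MHessian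

namespace MHessian

/-! ### Calculus at a maximum, the maximum principle, and a continuity argument. -/

theorem hessian_apply {n : ℕ} {g : EuclideanSpace ℝ (Fin n) → ℝ} {x : EuclideanSpace ℝ (Fin n)}
    (hg : ContDiffAt ℝ 2 g x) (i j : Fin n) :
    hessian g x i j =
      fderiv ℝ (fderiv ℝ g) x (EuclideanSpace.single i 1) (EuclideanSpace.single j 1) := by
  have hd : DifferentiableAt ℝ (fderiv ℝ g) x :=
    (hg.fderiv_right (m := 1) (by norm_num)).differentiableAt one_ne_zero
  have h := (hd.hasFDerivAt.clm_apply (hasFDerivAt_const (EuclideanSpace.single j (1 : ℝ)) x)).fderiv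
  show fderiv ℝ (fun y => fderiv ℝ g y (EuclideanSpace.single j 1)) x _ = _
  rw [h]
  simp

theorem isSymm_hessian {n : ℕ} {g : EuclideanSpace ℝ (Fin n) → ℝ} {x : EuclideanSpace ℝ (Fin n)}
    (hg : ContDiffAt ℝ 2 g x) : (hessian g x).IsSymm := by
  ext i j
  rw [Matrix.transpose_apply, hessian_apply hg, hessian_apply hg]
  exact hg.isSymmSndFDerivAt (by simp) _ _

theorem hessian_linear {n : ℕ} {g h : EuclideanSpace ℝ (Fin n) → ℝ}
    {x : EuclideanSpace ℝ (Fin n)} (hg : ContDiffAt ℝ 2 g x) (hh : ContDiffAt ℝ 2 h x)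
    (p q c : ℝ) :
    hessian (fun y => p * g y + q * h y + c) x = p • hessian g x + q • hessian h x := by
  have hd : ∀ {g : EuclideanSpace ℝ (Fin n) → ℝ}, ContDiffAt ℝ 2 g x →
      DifferentiableAt ℝ (fderiv ℝ g) x := fun hg =>
    (hg.fderiv_right (m := 1) (by norm_num)).differentiableAt one_ne_zero
  have he : ∀ {g : EuclideanSpace ℝ (Fin n) → ℝ}, ContDiffAt ℝ 2 g x →
      ∀ᶠ y in 𝓝 x, DifferentiableAt ℝ g y := fun hg =>
    (hg.eventually (by simp)).mono fun y hy => hy.differentiableAt two_ne_zero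
  have hw : ContDiffAt ℝ 2 (fun y => p * g y + q * h y + c) x :=
    ((contDiffAt_const.mul hg).add (contDiffAt_const.mul hh)).add contDiffAt_const
  have hF : fderiv ℝ (fun y => p * g y + q * h y + c) =ᶠ[𝓝 x]
      fun y => p • fderiv ℝ g y + q • fderiv ℝ h y := by
    filter_upwards [he hg, he hh] with y h1 h2
    exact (((h1.hasFDerivAt.const_mul p).add (h2.hasFDerivAt.const_mul q)).add_const c).fderiv
  have h2 := (((hd hg).hasFDerivAt.const_smul p).add ((hd hh).hasFDerivAt.const_smul q)).fderiv
  ext i j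
  rw [hessian_apply hw, hF.fderiv_eq]
  erw [h2]
  simp [hessian_apply hg, hessian_apply hh]

/-- A positive second derivative would make `0` a local minimum as well, hence `φ` locally constant.
-/
theorem second_deriv_nonpos_of_isLocalMax {φ : ℝ → ℝ} (hc : ContinuousAt φ 0)
    (h : IsLocalMax φ 0) : deriv (deriv φ) 0 ≤ 0 := by
  by_contra hpos
  push Not at hpos
  have hmin := isLocalMin_of_deriv_deriv_pos hpos h.deriv_eq_zero hc
  have hconst : φ =ᶠ[𝓝 0] fun _ => φ 0 := by
    filter_upwards [h, hmin] with s h1 h2 using le_antisymm h1 h2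
  have h1 : deriv φ =ᶠ[𝓝 0] fun _ => 0 := by
    refine hconst.deriv.trans ?_
    simp
  rw [h1.deriv_eq] at hpos
  simp at hpos

theorem hasDerivAt_clm_line {E : Type*} [NormedAddCommGroup E] [NormedSpace ℝ E]
    {F : E → E →L[ℝ] ℝ} {F' : E →L[ℝ] E →L[ℝ] ℝ} {x : E} (hF : HasFDerivAt F F' x) (Y : E) :
    HasDerivAt (fun s : ℝ => F (x + s • Y) Y) (F' Y Y) 0 := by
  have hline : HasDerivAt (fun s : ℝ => x + s • Y) Y 0 := by
    simpa using ((hasDerivAt_id (0 : ℝ)).smul_const Y).const_add x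
  have h1 : HasDerivAt (fun s : ℝ => F (x + s • Y)) (F' Y) 0 :=
    hF.comp_hasDerivAt_of_eq (0 : ℝ) hline (by simp)
  exact (ContinuousLinearMap.apply ℝ ℝ Y).hasFDerivAt.comp_hasDerivAt (0 : ℝ) h1

theorem posSemidef_neg_hessian {n : ℕ} {g : EuclideanSpace ℝ (Fin n) → ℝ}
    {x : EuclideanSpace ℝ (Fin n)} (hg : ContDiffAt ℝ 2 g x) (h : IsLocalMax g x) :
    (-hessian g x).PosSemidef := by
  refine Matrix.PosSemidef.of_dotProduct_mulVec_nonneg ?_ fun y => ?_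
  · rw [Matrix.IsHermitian, Matrix.conjTranspose_eq_transpose_of_trivial]
    exact (isSymm_hessian hg).neg
  set Y : EuclideanSpace ℝ (Fin n) := WithLp.toLp 2 y
  have hY : Y = ∑ i, y i • EuclideanSpace.single i (1 : ℝ) := by
    ext j
    simp [Y, Finset.sum_apply, Pi.single_apply]
  have hd : DifferentiableAt ℝ (fderiv ℝ g) x :=
    (hg.fderiv_right (m := 1) (by norm_num)).differentiableAt one_ne_zero
  have hline : ∀ s : ℝ, HasDerivAt (fun s : ℝ => x + s • Y) Y s := fun s => by
    simpa using ((hasDerivAt_id s).smul_const Y).const_add x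
  have hx0 : x + (0 : ℝ) • Y = x := by simp
  have htend : Tendsto (fun s : ℝ => x + s • Y) (𝓝 0) (𝓝 x) := by
    have := (hline 0).continuousAt.tendsto
    rwa [hx0] at this
  have hmax : IsLocalMax (fun s : ℝ => g (x + s • Y)) 0 := by
    filter_upwards [htend.eventually h] with s hs
    simpa using hs
  have h1 : deriv (fun s : ℝ => g (x + s • Y)) =ᶠ[𝓝 0] fun s => fderiv ℝ g (x + s • Y) Y := by
    filter_upwards [htend.eventually ((hg.eventually (by simp)).mono
      fun y hy => hy.differentiableAt two_ne_zero)] with s hs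
    exact (hs.hasFDerivAt.comp_hasDerivAt s (hline s)).deriv
  have h2 : HasDerivAt (fun s : ℝ => fderiv ℝ g (x + s • Y) Y) (fderiv ℝ (fderiv ℝ g) x Y Y) 0 :=
    hasDerivAt_clm_line hd.hasFDerivAt Y
  have hc : ContinuousAt (fun s : ℝ => g (x + s • Y)) 0 := by
    refine ContinuousAt.comp (g := g) ?_ (hline 0).continuousAt
    rw [hx0]; exact hg.continuousAt
  have h3 := second_deriv_nonpos_of_isLocalMax hc hmax
  rw [h1.deriv_eq, h2.deriv, hY] at h3
  have h4 : star y ⬝ᵥ (-hessian g x).mulVec y = -∑ i, ∑ j, y j * (y i * hessian g x i j) := by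
    simp only [dotProduct, Matrix.mulVec, Matrix.neg_apply, star_trivial, Finset.mul_sum,
      ← Finset.sum_neg_distrib]
    refine Finset.sum_congr rfl fun i _ => Finset.sum_congr rfl fun j _ => ?_
    ring
  rw [h4]
  simp only [map_sum, map_smul, sum_apply, smul_apply,
    smul_eq_mul, ← hessian_apply hg, Finset.mul_sum] at h3
  rw [Finset.sum_comm] at h3
  linarith

theorem deriv_nonneg_of_isMaxOn_left {φ : ℝ → ℝ} {d t t₁ : ℝ} (ht : t₁ < t)
    (hφ : HasDerivAt φ d t) (hmax : ∀ s ∈ Icc t₁ t, φ s ≤ φ t) : 0 ≤ d := by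
  by_contra hd
  push Not at hd
  have h := (hasDerivAt_iff_tendsto_slope.1 hφ).eventually (gt_mem_nhds hd)
  have h' : ∀ᶠ s in 𝓝[<] t, slope φ t s < 0 := h.filter_mono (nhdsWithin_mono _ fun s hs => ne_of_lt hs)
  obtain ⟨s, hs, hs1, hs2⟩ := (h'.and (Ioo_mem_nhdsLT ht)).exists
  rw [slope_def_field] at hs
  have := hmax s ⟨hs1.le, hs2.le⟩
  have : 0 ≤ (φ s - φ t) / (s - t) := div_nonneg_of_nonpos (by linarith) (by linarith)
  linarith

/-- The parabolic maximum principle: a function which is nonpositive on the parabolic boundary of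
a bounded cylinder and cannot have an interior spatial maximum with nonnegative time derivative
is nonpositive. -/
theorem le_zero_of_parabolic {n : ℕ} {Ω : Set (EuclideanSpace ℝ (Fin n))} (hΩ : IsOpen Ω)
    (hb : Bornology.IsBounded Ω) {w w' : EuclideanSpace ℝ (Fin n) → ℝ → ℝ} {t₁ T : ℝ}
    (hw : ContinuousOn (fun z : EuclideanSpace ℝ (Fin n) × ℝ => w z.1 z.2)
      (closure Ω ×ˢ Icc t₁ T))
    (hC : ∀ t ∈ Ioc t₁ T, ContDiffOn ℝ 2 (fun x => w x t) Ω)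
    (hD : ∀ x ∈ Ω, ∀ t ∈ Ioc t₁ T, HasDerivAt (w x) (w' x t) t)
    (hbot : ∀ x ∈ Ω, w x t₁ ≤ 0) (hlat : ∀ x ∈ frontier Ω, ∀ t ∈ Icc t₁ T, w x t ≤ 0)
    (hint : ∀ x ∈ Ω, ∀ t ∈ Ioc t₁ T, 0 ≤ w' x t →
      (-hessian (fun y => w y t) x).PosSemidef → False) :
    ∀ x ∈ closure Ω, ∀ t ∈ Icc t₁ T, w x t ≤ 0 := by
  intro x hx t ht
  have hK : IsCompact (closure Ω ×ˢ Icc t₁ T) := hb.isCompact_closure.prod isCompact_Icc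
  obtain ⟨⟨y, s⟩, ⟨hy, hs⟩, hmax⟩ := hK.exists_isMaxOn ⟨(x, t), hx, ht⟩ hw
  have hmax' : ∀ x ∈ closure Ω, ∀ t ∈ Icc t₁ T, w x t ≤ w y s := fun x hx t ht =>
    hmax (show (x, t) ∈ closure Ω ×ˢ Icc t₁ T from ⟨hx, ht⟩)
  refine (hmax' x hx t ht).trans ?_
  by_cases hyΩ : y ∈ Ω
  · rcases hs.1.eq_or_lt with rfl | hlt
    · exact hbot y hyΩ
    · exfalso
      have hs' : s ∈ Ioc t₁ T := ⟨hlt, hs.2⟩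
      refine hint y hyΩ s hs' ?_ ?_
      · exact deriv_nonneg_of_isMaxOn_left hlt (hD y hyΩ s hs') fun r hr =>
          hmax' y hy r ⟨hr.1, hr.2.trans hs.2⟩
      · refine posSemidef_neg_hessian ((hC s hs').contDiffAt (hΩ.mem_nhds hyΩ)) ?_
        filter_upwards [hΩ.mem_nhds hyΩ] with z hz
        exact hmax' z (subset_closure hz) s hs
  · refine hlat y ?_ s hs
    rw [hΩ.frontier_eq]
    exact ⟨hy, hyΩ⟩

/-- The minimum of the `c k` is continuous. Were it nonpositive somewhere, it would take the value
`0`, which `hstep` excludes. -/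
theorem pos_of_preconnected {X : Type*} [TopologicalSpace X] {Q : Set X} (hQ : IsPreconnected Q)
    {m : ℕ} {c : ℕ → X → ℝ} (hc : ∀ k ≤ m, ContinuousOn (c k) Q)
    (hstep : ∀ z ∈ Q, (∀ k ≤ m, 0 ≤ c k z) → ∀ k ≤ m, 0 < c k z) {z₀ : X} (hz₀ : z₀ ∈ Q)
    (h₀ : ∀ k ≤ m, 0 < c k z₀) : ∀ z ∈ Q, ∀ k ≤ m, 0 < c k z := by
  intro z hz
  have hne : (Finset.range (m + 1)).Nonempty := ⟨0, by simp⟩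
  set φ : X → ℝ := fun z => (Finset.range (m + 1)).inf' hne fun k => c k z
  have hlt : ∀ z a, a < φ z ↔ ∀ k ≤ m, a < c k z := fun z a => by
    simp [φ, Finset.lt_inf'_iff]
  have hle : ∀ z a, a ≤ φ z ↔ ∀ k ≤ m, a ≤ c k z := fun z a => by
    simp [φ, Finset.le_inf'_iff]
  have hφ : ContinuousOn φ Q :=
    ContinuousOn.finset_inf'_apply hne fun k hk => hc k (Nat.lt_succ_iff.1 (Finset.mem_range.1 hk))
  rw [← hlt]
  by_contra hneg
  push Not at hneg
  obtain ⟨y, hy, hy0⟩ := hQ.intermediate_value hz hz₀ hφ ⟨hneg, ((hlt _ _).2 h₀).le⟩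
  exact ((hlt y 0).2 (hstep y hy ((hle y 0).1 hy0.ge))).ne' hy0

end MHessian

namespace MHessian

/-! ### Admissibility of `u` and comparison with barriers. -/

theorem pTrace_smul {n : ℕ} (p : ℕ) (a : ℝ) (S : Matrix (Fin n) (Fin n) ℝ) :
    pTrace p (a • S) = a ^ p * pTrace p S := by
  simp only [pTrace, Finset.mul_sum]
  refine Finset.sum_congr rfl fun I hI => ?_
  rw [Matrix.submatrix_smul, Pi.smul_apply, Pi.smul_apply, Matrix.det_smul, Fintype.card_coe,
    (Finset.mem_powersetCard.1 hI).2]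

theorem IsMPositive.smul {n m : ℕ} {a : ℝ} (ha : 0 < a) {S : Matrix (Fin n) (Fin n) ℝ}
    (hS : IsMPositive m S) : IsMPositive m (a • S) := by
  refine ⟨hS.1.smul a, fun p h1 h2 => ?_⟩
  rw [pTrace_smul]
  exact mul_pos (pow_pos ha p) (hS.2 p h1 h2)

theorem blockTrace_eq {n m : ℕ} (hm : 1 ≤ m) (s : ℝ) (S : Matrix (Fin n) (Fin n) ℝ) :
    blockTrace s S m = s * pTrace (m - 1) S + pTrace m S := by
  obtain ⟨k, rfl⟩ := Nat.exists_eq_add_of_le' hm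
  rw [blockTrace_succ, Nat.add_sub_cancel]

theorem blockTrace_smul {n m : ℕ} (hm : 1 ≤ m) (s a : ℝ) (S : Matrix (Fin n) (Fin n) ℝ) :
    blockTrace s (a • S) m = s * (a ^ (m - 1) * pTrace (m - 1) S) + a ^ m * pTrace m S := by
  rw [blockTrace_eq hm, pTrace_smul, pTrace_smul]

theorem evolOp_eq_blockTrace {n m : ℕ} (hm : 1 ≤ m) (u : EuclideanSpace ℝ (Fin n) → ℝ → ℝ)
    (x : EuclideanSpace ℝ (Fin n)) (t : ℝ) :
    evolOp m u x t = blockTrace (-timeDeriv u x t) (hessian (fun y => u y t) x) m := by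
  rw [blockTrace_eq hm, evolOp]

theorem IsC21.hasDerivAt {n : ℕ} {Ω : Set (EuclideanSpace ℝ (Fin n))}
    {u : EuclideanSpace ℝ (Fin n) → ℝ → ℝ} (hu : IsC21 Ω u) {x : EuclideanSpace ℝ (Fin n)}
    (hx : x ∈ Ω) {t : ℝ} (ht : 0 < t) : HasDerivAt (u x) (timeDeriv u x t) t :=
  (hu.differentiableOn_time x hx t ht.le).hasDerivWithinAt.hasDerivAt (Ici_mem_nhds ht)

/-- `u` is `m`-admissible on `Ω × [t₀, ∞)`: `diag(-u_t, u_xx)` is `m`-positive there. -/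
def IsAdmissible {n : ℕ} (m : ℕ) (Ω : Set (EuclideanSpace ℝ (Fin n)))
    (u : EuclideanSpace ℝ (Fin n) → ℝ → ℝ) (t₀ : ℝ) : Prop :=
  ∀ x ∈ Ω, ∀ t, t₀ ≤ t →
    ∀ k ≤ m, 0 < blockTrace (-timeDeriv u x t) (hessian (fun y => u y t) x) k

theorem continuousOn_pTrace {n : ℕ} {X : Type*} [TopologicalSpace X] {Q : Set X}
    {M : X → Matrix (Fin n) (Fin n) ℝ} (hM : ∀ i j, ContinuousOn (fun z => M z i j) Q) (p : ℕ) :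
    ContinuousOn (fun z => pTrace p (M z)) Q := by
  unfold pTrace
  refine continuousOn_finsetSum _ fun I _ => ?_
  simp only [Matrix.det_apply, Matrix.submatrix_apply]
  refine continuousOn_finsetSum _ fun σ _ => ContinuousOn.const_smul ?_ _
  exact continuousOn_finsetProd _ fun i _ => hM _ _

theorem isAdmissible_of_evolOp_pos {n m : ℕ} (hm : 1 ≤ m) {Ω : Set (EuclideanSpace ℝ (Fin n))}
    (hΩ : IsOpen Ω) (hΩc : IsConnected Ω) {u : EuclideanSpace ℝ (Fin n) → ℝ → ℝ}
    (hu : IsC21 Ω u) {x₀ : EuclideanSpace ℝ (Fin n)} (hx₀ : x₀ ∈ Ω) {t₀ : ℝ} (ht₀ : 0 ≤ t₀)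
    (hpos : IsMPositive m (hessian (fun y => u y t₀) x₀))
    (hE : ∀ x ∈ Ω, ∀ t, t₀ ≤ t → 0 < evolOp m u x t) : IsAdmissible m Ω u t₀ := by
  have hsub : Ω ×ˢ Ici t₀ ⊆ Ω ×ˢ Ici 0 := prod_mono_right (Ici_subset_Ici.2 ht₀)
  have hQ : IsPreconnected (Ω ×ˢ Ici t₀) := hΩc.isPreconnected.prod isPreconnected_Ici
  have hT : ∀ p, ContinuousOn (fun z : EuclideanSpace ℝ (Fin n) × ℝ =>
      pTrace p (hessian (fun y => u y z.2) z.1)) (Ω ×ˢ Ici t₀) := fun p =>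
    continuousOn_pTrace (fun i j => (hu.continuousOn_hessian i j).mono hsub) p
  have hev : ∀ x ∈ Ω, ∀ t, t₀ ≤ t →
      0 < blockTrace (-timeDeriv u x t) (hessian (fun y => u y t) x) m := fun x hx t ht => by
    rw [← evolOp_eq_blockTrace hm]; exact hE x hx t ht
  have key := pos_of_preconnected (m := m) (c := fun k z =>
    blockTrace (-timeDeriv u z.1 z.2) (hessian (fun y => u y z.2) z.1) k) hQ ?_ ?_
    (z₀ := (x₀, t₀)) ⟨hx₀, le_refl t₀⟩ (blockTrace_pos_of_isMPositive hpos (hev x₀ hx₀ t₀ le_rfl))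
  · exact fun x hx t ht => key (x, t) ⟨hx, ht⟩
  · rintro (_ | k) -
    · simp only [blockTrace_zero]; exact continuousOn_const
    · simp only [blockTrace_succ]
      exact ((hu.continuousOn_timeDeriv.mono hsub).neg.mul (hT k)).add (hT (k + 1))
  · rintro ⟨x, t⟩ ⟨hx, ht⟩ h
    exact blockTrace_pos_of_nonneg (isSymm_hessian
      ((hu.contDiffOn_space t (ht₀.trans ht)).contDiffAt (hΩ.mem_nhds hx))) h (hev x hx t ht)

/-- At a positive interior maximum of `u` minus the barrier, `-u_t ≤ η` and `u_xx ≤ a v_xx`.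
Monotonicity starts from the admissible `u`, so nothing is asked of the barrier and `a = 0` is
allowed. -/
theorem le_upper_barrier {n m : ℕ} (hm : 1 ≤ m) {Ω : Set (EuclideanSpace ℝ (Fin n))}
    (hΩ : IsOpen Ω) (hb : Bornology.IsBounded Ω) {v : EuclideanSpace ℝ (Fin n) → ℝ}
    (hv : ContDiffOn ℝ 2 v Ω) (hvc : ContinuousOn v (closure Ω))
    {u : EuclideanSpace ℝ (Fin n) → ℝ → ℝ} (hu : IsC21 Ω u)
    (huc : ContinuousOn (fun z : EuclideanSpace ℝ (Fin n) × ℝ => u z.1 z.2) (closure Ω ×ˢ Ici 0))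
    {t₀ : ℝ} (hadm : IsAdmissible m Ω u t₀) {t₁ T : ℝ} (h0 : 0 ≤ t₁) (h01 : t₀ ≤ t₁)
    (a c η : ℝ)
    (hE : ∀ x ∈ Ω, ∀ t, t₁ ≤ t → blockTrace η (a • hessian v x) m < evolOp m u x t)
    (hbot : ∀ x ∈ Ω, u x t₁ ≤ a * v x + (c - η * t₁))
    (hlat : ∀ x ∈ frontier Ω, ∀ t ∈ Icc t₁ T, u x t ≤ a * v x + (c - η * t)) :
    ∀ x ∈ closure Ω, ∀ t ∈ Icc t₁ T, u x t ≤ a * v x + (c - η * t) := by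
  have key := le_zero_of_parabolic (T := T) (t₁ := t₁) hΩ hb
    (w := fun x t => 1 * u x t + (-a) * v x + (-(c - η * t)))
    (w' := fun x t => timeDeriv u x t + η) ?_ ?_ ?_ ?_ ?_ ?_
  · intro x hx t ht
    have := key x hx t ht
    linarith
  · refine ContinuousOn.add (ContinuousOn.add (continuousOn_const.mul
      (huc.mono (prod_mono_right fun t ht => h0.trans ht.1))) (continuousOn_const.mul
      (hvc.comp continuousOn_fst fun z hz => hz.1))) ?_
    fun_prop
  · intro t ht
    exact ((contDiffOn_const.mul (hu.contDiffOn_space t (h0.trans ht.1.le))).add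
      (contDiffOn_const.mul hv)).add contDiffOn_const
  · intro x hx t ht
    have h1 := hu.hasDerivAt hx (h0.trans_lt ht.1)
    have h2 := (((h1.const_mul 1).add_const (-a * v x)).add
      ((((hasDerivAt_id t).const_mul η).const_sub c).neg))
    convert! h2 using 1
    simp
  · intro x hx
    have := hbot x hx
    linarith
  · intro x hx t ht
    have := hlat x hx t ht
    linarith
  · intro x hx t ht hd hp
    have hux := (hu.contDiffOn_space t (h0.trans ht.1.le)).contDiffAt (hΩ.mem_nhds hx)
    have hvx := hv.contDiffAt (hΩ.mem_nhds hx)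
    rw [hessian_linear hux hvx] at hp
    have hp' : (a • hessian v x - hessian (fun y => u y t) x).PosSemidef := by
      convert! hp using 1
      simp [sub_eq_add_neg]
    have h1 := blockTrace_mono (s' := η) (by linarith) (isSymm_hessian hux) hp'
      (hadm x hx t (h01.trans ht.1.le)) m le_rfl
    rw [← evolOp_eq_blockTrace hm] at h1
    exact absurd (hE x hx t ht.1.le) (not_lt.2 h1)

/-- Here the barrier is the smaller matrix and must lie in the cone itself: this follows from `a >
0`, admissibility of `v` and the positive `m`-trace given by `hEpos` and `hE`. -/
theorem lower_barrier_le {n m : ℕ} (hm : 1 ≤ m) {Ω : Set (EuclideanSpace ℝ (Fin n))}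
    (hΩ : IsOpen Ω) (hb : Bornology.IsBounded Ω) {v : EuclideanSpace ℝ (Fin n) → ℝ}
    (hv : ContDiffOn ℝ 2 v Ω) (hvc : ContinuousOn v (closure Ω))
    (hvp : ∀ x ∈ Ω, IsMPositive m (hessian v x))
    {u : EuclideanSpace ℝ (Fin n) → ℝ → ℝ} (hu : IsC21 Ω u)
    (huc : ContinuousOn (fun z : EuclideanSpace ℝ (Fin n) × ℝ => u z.1 z.2) (closure Ω ×ˢ Ici 0))
    {t₁ T : ℝ} (h0 : 0 ≤ t₁) {a : ℝ} (ha : 0 < a) (c η : ℝ)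
    (hEpos : ∀ x ∈ Ω, ∀ t, t₁ ≤ t → 0 < evolOp m u x t)
    (hE : ∀ x ∈ Ω, ∀ t, t₁ ≤ t → evolOp m u x t < blockTrace (-η) (a • hessian v x) m)
    (hbot : ∀ x ∈ Ω, a * v x + (c + η * t₁) ≤ u x t₁)
    (hlat : ∀ x ∈ frontier Ω, ∀ t ∈ Icc t₁ T, a * v x + (c + η * t) ≤ u x t) :
    ∀ x ∈ closure Ω, ∀ t ∈ Icc t₁ T, a * v x + (c + η * t) ≤ u x t := by
  have key := le_zero_of_parabolic (T := T) (t₁ := t₁) hΩ hb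
    (w := fun x t => (-1) * u x t + a * v x + (c + η * t))
    (w' := fun x t => -timeDeriv u x t + η) ?_ ?_ ?_ ?_ ?_ ?_
  · intro x hx t ht
    have := key x hx t ht
    linarith
  · refine ContinuousOn.add (ContinuousOn.add (continuousOn_const.mul
      (huc.mono (prod_mono_right fun t ht => h0.trans ht.1))) (continuousOn_const.mul
      (hvc.comp continuousOn_fst fun z hz => hz.1))) ?_
    fun_prop
  · intro t ht
    exact ((contDiffOn_const.mul (hu.contDiffOn_space t (h0.trans ht.1.le))).add
      (contDiffOn_const.mul hv)).add contDiffOn_const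
  · intro x hx t ht
    have h1 := hu.hasDerivAt hx (h0.trans_lt ht.1)
    have h2 := (((h1.const_mul (-1)).add_const (a * v x)).add
      (((hasDerivAt_id t).const_mul η).const_add c))
    convert! h2 using 1
    simp
  · intro x hx
    have := hbot x hx
    linarith
  · intro x hx t ht
    have := hlat x hx t ht
    linarith
  · intro x hx t ht hd hp
    have hux := (hu.contDiffOn_space t (h0.trans ht.1.le)).contDiffAt (hΩ.mem_nhds hx)
    have hvx := hv.contDiffAt (hΩ.mem_nhds hx)
    rw [hessian_linear hux hvx] at hp
    have hp' : (hessian (fun y => u y t) x - a • hessian v x).PosSemidef := by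
      convert! hp using 1
      simp [sub_eq_add_neg, add_comm]
    have hva := (hvp x hx).smul ha
    have hlt := hE x hx t ht.1.le
    have h1 := blockTrace_mono (s := -η) (s' := -timeDeriv u x t) (by linarith) hva.1 hp'
      (blockTrace_pos_of_isMPositive hva ((hEpos x hx t ht.1.le).trans hlt)) m le_rfl
    rw [← evolOp_eq_blockTrace hm] at h1
    exact absurd hlt (not_lt.2 h1)

end MHessian

namespace MHessian

/-! ### Choice of parameters and conclusion. -/

theorem pTrace_pos {n m : ℕ} {S : Matrix (Fin n) (Fin n) ℝ} (hS : IsMPositive m S) :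
    ∀ k ≤ m, 0 < pTrace k S := by
  rintro (_ | k) hk
  · rw [pTrace_zero]; exact one_pos
  · exact hS.2 _ (by omega) hk

/-- The small parameters of the barriers `(1 ± δ) v ± (ε + δ V + η (T - t))`. -/
theorem exists_barrier_parameters {m : ℕ} (hm : 1 ≤ m) {e V κ ν : ℝ} (he : 0 < e) (hV : 0 ≤ V)
    (hκ : 0 < κ) (hν : 0 < ν) :
    ∃ δ ε η : ℝ, 0 < δ ∧ δ ≤ 1 / 2 ∧ 0 < ε ∧ 0 < η ∧ m * ε ≤ δ / 2 ∧ ε + 2 * (δ * V) < e ∧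
      ∀ a ∈ Icc (0 : ℝ) 2, ∀ τ, 0 ≤ τ → τ ≤ κ → η * (a ^ (m - 1) * τ) < δ / 2 * ν := by
  have hm' : (0 : ℝ) < m := by exact_mod_cast hm
  set δ := min (1 / 2) (e / (8 * (V + 1)))
  have hδ : 0 < δ := lt_min (by norm_num) (by positivity)
  have hδV : δ * V ≤ e / 8 := by
    have : δ * (V + 1) ≤ e / 8 := by
      calc δ * (V + 1) ≤ e / (8 * (V + 1)) * (V + 1) :=
            mul_le_mul_of_nonneg_right (min_le_right _ _) (by positivity)
        _ = e / 8 := by field_simp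
    linarith
  -- `2 ^ (m - 1) * κ` bounds `a ^ (m - 1) * τ`; the extra factor `2` makes the final inequality
  -- strict.
  set B : ℝ := 2 ^ (m - 1) * (2 * κ)
  have hB : 0 < B := by positivity
  refine ⟨δ, min (e / 8) (δ / 2 / m), δ / 2 * ν / B, hδ, min_le_left _ _,
    lt_min (by positivity) (by positivity), by positivity, ?_, ?_, ?_⟩
  · calc (m : ℝ) * min (e / 8) (δ / 2 / m) ≤ m * (δ / 2 / m) :=
          mul_le_mul_of_nonneg_left (min_le_right _ _) hm'.le
      _ = δ / 2 := by field_simp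
  · have := min_le_left (e / 8) (δ / 2 / m)
    linarith
  · intro a ha τ hτ0 hτ
    have h1 : a ^ (m - 1) * τ < B := by
      calc a ^ (m - 1) * τ ≤ 2 ^ (m - 1) * κ :=
            mul_le_mul (pow_le_pow_left₀ ha.1 ha.2 _) hτ hτ0 (by positivity)
        _ < B := mul_lt_mul_of_pos_left (by linarith) (by positivity)
    calc δ / 2 * ν / B * (a ^ (m - 1) * τ) < δ / 2 * ν / B * B :=
          mul_lt_mul_of_pos_left h1 (by positivity)
      _ = δ / 2 * ν := by field_simp

end MHessian

theorem theorem5p3 {n m : ℕ} (hm : 1 ≤ m) (hmn : m ≤ n)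
    -- the bounded domain
    (Ω : Set (EuclideanSpace ℝ (Fin n))) (hΩ_open : IsOpen Ω) (hΩ_conn : IsConnected Ω)
    (hΩ_bdd : Bornology.IsBounded Ω)
    -- the stationary solution `v`; on `∂Ω` it equals `Φ`
    (f Φ v : EuclideanSpace ℝ (Fin n) → ℝ)
    (hv : MHessian.IsStationarySolution m Ω f Φ v)
    (ν_m μ_m μ_m' : ℝ) (hν_m : 0 < ν_m) (hf_lower : ∀ x ∈ Ω, ν_m ≤ f x)
    (hv_m : ∀ x ∈ Ω, MHessian.pTrace m (MHessian.hessian v x) ≤ μ_m)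
    (hv_m' : ∀ x ∈ Ω, MHessian.pTrace (m - 1) (MHessian.hessian v x) ≤ μ_m')
    -- the evolution `u`
    (u : EuclideanSpace ℝ (Fin n) → ℝ → ℝ) (hu : MHessian.IsC21 Ω u)
    (hu_cont : ContinuousOn (fun z : EuclideanSpace ℝ (Fin n) × ℝ => u z.1 z.2)
      (closure Ω ×ˢ Ici 0))
    (x₀ : EuclideanSpace ℝ (Fin n)) (hx₀ : x₀ ∈ Ω) (t₀ : ℝ) (ht₀ : 0 ≤ t₀)
    (hu_pos : MHessian.IsMPositive m (MHessian.hessian (fun y => u y t₀) x₀))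
    (ν μ : ℝ) (hν : 0 < ν)
    (hE_lower : ∀ x ∈ Ω, ∀ t : ℝ, t₀ ≤ t → ν ≤ MHessian.evolOp m u x t)
    (hE_upper : ∀ x ∈ Ω, ∀ t : ℝ, t₀ ≤ t → MHessian.evolOp m u x t ≤ μ)
    -- the upper barrier condition
    (h₁ h₂ : ℝ → ℝ)
    (h₁_pos : ∀ t : ℝ, t₀ ≤ t → 0 < h₁ t) (h₂_pos : ∀ t : ℝ, t₀ ≤ t → 0 < h₂ t)
    (h₁_anti : AntitoneOn h₁ (Ici t₀)) (h₂_anti : AntitoneOn h₂ (Ici t₀))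
    (hub_boundary : ∀ z ∈ MHessian.parabolicBoundary Ω t₀, u z.1 z.2 - v z.1 ≤ h₁ z.2)
    (hub_interior : ∀ x ∈ Ω, ∀ t : ℝ, t₀ ≤ t →
      (1 / (m : ℝ)) * (1 - MHessian.evolOp m u x t / f x) ≤ h₂ t)
    -- the lower barrier condition
    (h_neg : ℝ → ℝ) (h_neg_pos : ∀ t : ℝ, t₀ ≤ t → 0 < h_neg t)
    (h_neg_anti : AntitoneOn h_neg (Ici t₀))
    (hlb_boundary : ∀ z ∈ MHessian.parabolicBoundary Ω t₀, -h_neg z.2 ≤ u z.1 z.2 - v z.1)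
    (hlb_interior : ∀ x ∈ Ω, ∀ t : ℝ, t₀ ≤ t →
      -h_neg t ≤ (1 / (m : ℝ)) * (1 - MHessian.evolOp m u x t / f x)) :
    (∃ C : ℝ, ∀ x ∈ Ω, ∀ t : ℝ, 0 ≤ t → |u x t| ≤ C) ∧
    (Tendsto (fun t => max (max (h₁ t) (h₂ t)) (h_neg t)) atTop (𝓝 0) →
      TendstoUniformlyOn (fun t x => u x t) v atTop (closure Ω)) := by
  have hvB := hΩ_bdd.isCompact_closure.exists_bound_of_continuousOn hv.continuousOn
  obtain ⟨V, hV⟩ := hvB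
  have hV' : ∀ x ∈ closure Ω, -V ≤ v x ∧ v x ≤ V := fun x hx => abs_le.1 (hV x hx)
  have hcl := fun x (hx : x ∈ Ω) => subset_closure hx
  have hV0 : 0 ≤ V := (norm_nonneg _).trans (hV x₀ (hcl x₀ hx₀))
  have hfr := fun x (hx : x ∈ frontier Ω) => frontier_subset_closure hx
  have hEpos : ∀ x ∈ Ω, ∀ t, t₀ ≤ t → 0 < MHessian.evolOp m u x t := fun x hx t ht =>
    hν.trans_le (hE_lower x hx t ht)
  have hadm := MHessian.isAdmissible_of_evolOp_pos hm hΩ_open hΩ_conn hu hx₀ ht₀ hu_pos hEpos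
  have hlatU : ∀ x ∈ frontier Ω, ∀ t, t₀ ≤ t → u x t - v x ≤ h₁ t := fun x hx t ht =>
    hub_boundary (x, t) (Or.inr ⟨hx, ht⟩)
  have hlatL : ∀ x ∈ frontier Ω, ∀ t, t₀ ≤ t → -h_neg t ≤ u x t - v x := fun x hx t ht =>
    hlb_boundary (x, t) (Or.inr ⟨hx, ht⟩)
  have hbotU : ∀ x ∈ Ω, u x t₀ - v x ≤ h₁ t₀ := fun x hx =>
    hub_boundary (x, t₀) (Or.inl ⟨hx, rfl⟩)
  have hbotL : ∀ x ∈ Ω, -h_neg t₀ ≤ u x t₀ - v x := fun x hx =>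
    hlb_boundary (x, t₀) (Or.inl ⟨hx, rfl⟩)
  have hupper : ∀ x ∈ closure Ω, ∀ t, t₀ ≤ t → u x t ≤ V + h₁ t₀ := by
    intro x hx t ht
    -- With `a = η = 0` the barrier is a constant, whose `m`-trace is `0` because `m ≥ 1`.
    have := MHessian.le_upper_barrier (T := t) hm hΩ_open hΩ_bdd hv.contDiffOn hv.continuousOn hu
      hu_cont hadm ht₀ le_rfl 0 (V + h₁ t₀) 0 ?_ ?_ ?_ x hx t ⟨ht, le_rfl⟩
    · linarith
    · intro x hx t ht
      rw [MHessian.blockTrace_smul hm, zero_pow (by omega : m ≠ 0), zero_mul, zero_mul, add_zero]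
      exact hEpos x hx t ht
    · intro x hx
      linarith [hbotU x hx, (hV' x (hcl x hx)).2]
    · intro x hx t ht
      linarith [hlatU x hx t ht.1, (hV' x (hfr x hx)).2, h₁_anti self_mem_Ici ht.1 ht.1]
  obtain ⟨L, hlower⟩ : ∃ L, ∀ x ∈ closure Ω, ∀ t, t₀ ≤ t → L ≤ u x t := by
    -- Chosen so that the `m`-trace of `A v_xx`, namely `A ^ m * f ≥ A * ν_m`, exceeds `μ`; `A ≥ 1`
    -- gives `A ≤ A ^ m`.
    set A : ℝ := max 1 (μ / ν_m + 1)
    have hA1 : 1 ≤ A := le_max_left _ _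
    have hAμ : μ < A * ν_m := by
      have h1 : μ / ν_m < A := lt_of_lt_of_le (lt_add_one _) (le_max_right _ _)
      rwa [div_lt_iff₀ hν_m] at h1
    refine ⟨-(A * V) - (A * V + V + h_neg t₀), fun x hx t ht => ?_⟩
    have hAV : ∀ x ∈ closure Ω, -(A * V) ≤ A * v x ∧ A * v x ≤ A * V := fun x hx =>
      ⟨by nlinarith [(hV' x hx).1], by nlinarith [(hV' x hx).2]⟩
    have := MHessian.lower_barrier_le (T := t) hm hΩ_open hΩ_bdd hv.contDiffOn hv.continuousOn
      hv.admissible hu hu_cont ht₀ (one_pos.trans_le hA1) (-(A * V + V + h_neg t₀)) 0 hEpos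
      ?_ ?_ ?_ x hx t ⟨ht, le_rfl⟩
    · linarith [(hAV x hx).1]
    · intro x hx t ht
      rw [MHessian.blockTrace_smul hm, neg_zero, zero_mul, zero_add, hv.equation x hx]
      calc MHessian.evolOp m u x t ≤ μ := hE_upper x hx t ht
        _ < A * ν_m := hAμ
        _ ≤ A ^ m * f x := mul_le_mul (le_self_pow₀ hA1 (by omega)) (hf_lower x hx) hν_m.le
            (by positivity)
    · intro x hx
      linarith [hbotL x hx, (hV' x (hcl x hx)).1, (hAV x (hcl x hx)).2]
    · intro x hx t ht
      linarith [hlatL x hx t ht.1, (hV' x (hfr x hx)).1, (hAV x (hfr x hx)).2,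
        h_neg_anti self_mem_Ici ht.1 ht.1]
  obtain ⟨C, hC⟩ : ∃ C, ∀ x ∈ closure Ω, ∀ t, t₀ ≤ t → |u x t| ≤ C :=
    ⟨max (V + h₁ t₀) (-L), fun x hx t ht => abs_le'.2 ⟨(hupper x hx t ht).trans (le_max_left _ _),
      (neg_le_neg (hlower x hx t ht)).trans (le_max_right _ _)⟩⟩
  refine ⟨?_, fun hlim => ?_⟩
  · obtain ⟨C', hC'⟩ := (hΩ_bdd.isCompact_closure.prod (isCompact_Icc (a := (0 : ℝ))
      (b := t₀))).exists_bound_of_continuousOn (hu_cont.mono (prod_mono_right fun t ht => ht.1))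
    refine ⟨max C C', fun x hx t ht => ?_⟩
    rcases le_total t₀ t with h | h
    · exact (hC x (hcl x hx) t h).trans (le_max_left _ _)
    · exact (hC' (x, t) ⟨hcl x hx, ht, h⟩).trans (le_max_right _ _)
  rw [Metric.tendstoUniformlyOn_iff]
  intro e he
  have hTpos : ∀ x ∈ Ω, 0 < MHessian.pTrace (m - 1) (MHessian.hessian v x) := fun x hx =>
    MHessian.pTrace_pos (hv.admissible x hx) _ (Nat.sub_le _ _)
  have hκ : 0 < μ_m' := (hTpos x₀ hx₀).trans_le (hv_m' x₀ hx₀)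
  obtain ⟨δ, ε, η, hδ, hδ1, hε, hη, hmε, hsmall, hpar⟩ :=
    MHessian.exists_barrier_parameters hm he hV0 hκ hν_m
  have hm' : (0 : ℝ) < m := by exact_mod_cast hm
  obtain ⟨t₁, ht₁⟩ := eventually_atTop.1
    ((hlim.eventually (gt_mem_nhds hε)).and (eventually_ge_atTop t₀))
  have h01 : t₀ ≤ t₁ := (ht₁ t₁ le_rfl).2
  have h0 : 0 ≤ t₁ := ht₀.trans h01
  have hh₁ : ∀ t, t₁ ≤ t → h₁ t ≤ ε := fun t ht =>
    ((le_max_left _ _).trans (le_max_left _ _)).trans (ht₁ t ht).1.le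
  have hh₂ : ∀ t, t₁ ≤ t → h₂ t ≤ ε := fun t ht =>
    ((le_max_right _ _).trans (le_max_left _ _)).trans (ht₁ t ht).1.le
  have hhn : ∀ t, t₁ ≤ t → h_neg t ≤ ε := fun t ht => (le_max_right _ _).trans (ht₁ t ht).1.le
  have hfpos : ∀ x ∈ Ω, 0 < f x := fun x hx => hν_m.trans_le (hf_lower x hx)
  -- Since `m ε ≤ δ / 2`, the interior conditions pin `E_m[u] / f` to within `δ / 2` of `1`, half
  -- the margin opened by `1 ∓ δ`.
  have hEl : ∀ x ∈ Ω, ∀ t, t₁ ≤ t → (1 - δ / 2) * f x ≤ MHessian.evolOp m u x t := by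
    intro x hx t ht
    have h := (hub_interior x hx t (h01.trans ht)).trans (hh₂ t ht)
    rw [one_div, inv_mul_le_iff₀ hm'] at h
    rw [← le_div_iff₀ (hfpos x hx)]
    linarith
  have hEu : ∀ x ∈ Ω, ∀ t, t₁ ≤ t → MHessian.evolOp m u x t ≤ (1 + δ / 2) * f x := by
    intro x hx t ht
    have h := (neg_le_neg (hhn t ht)).trans (hlb_interior x hx t (h01.trans ht))
    rw [one_div, le_inv_mul_iff₀ hm'] at h
    rw [← div_le_iff₀ (hfpos x hx)]
    linarith
  have hC0 := fun x (hx : x ∈ Ω) => abs_le.1 (hC x (hcl x hx) t₁ h01)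
  -- `T` is the time of the estimate; waiting `(C + V) / η` lets `η (T - t₁)` dominate `|u - v|` at
  -- time `t₁`.
  filter_upwards [eventually_ge_atTop t₁, eventually_ge_atTop (t₁ + (C + V) / η)] with T hT hT'
  have hηT : C + V ≤ η * (T - t₁) := by
    rw [← div_le_iff₀' hη]; linarith
  have hδv : ∀ x ∈ closure Ω, -(δ * V) ≤ δ * v x ∧ δ * v x ≤ δ * V := fun x hx =>
    ⟨by nlinarith [(hV' x hx).1], by nlinarith [(hV' x hx).2]⟩
  have hηt : ∀ t ∈ Icc t₁ T, 0 ≤ η * (T - t) := fun t ht =>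
    mul_nonneg hη.le (sub_nonneg.2 ht.2)
  have hU := MHessian.le_upper_barrier (T := T) hm hΩ_open hΩ_bdd hv.contDiffOn hv.continuousOn hu
    hu_cont hadm h0 h01 (1 - δ) (ε + δ * V + η * T) η ?_ ?_ ?_
  have hL := MHessian.lower_barrier_le (T := T) hm hΩ_open hΩ_bdd hv.contDiffOn hv.continuousOn
    hv.admissible hu hu_cont h0 (by linarith : 0 < 1 + δ) (-(ε + δ * V + η * T)) η
    (fun x hx t ht => hEpos x hx t (h01.trans ht)) ?_ ?_ ?_
  · intro x hx
    have h1 := hU x hx T ⟨hT, le_rfl⟩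
    have h2 := hL x hx T ⟨hT, le_rfl⟩
    rw [Real.dist_eq, abs_lt]
    constructor <;> linarith [hδv x hx]
  · intro x hx t ht
    rw [MHessian.blockTrace_smul hm, hv.equation x hx]
    have h1 := hpar (1 + δ) ⟨by linarith, by linarith⟩ _ (hTpos x hx).le (hv_m' x hx)
    have h2 : (1 + δ) * f x ≤ (1 + δ) ^ m * f x :=
      mul_le_mul_of_nonneg_right (le_self_pow₀ (by linarith) (by omega)) (hfpos x hx).le
    nlinarith [hEu x hx t ht, hf_lower x hx]
  · intro x hx
    linarith [hC0 x hx, hδv x (hcl x hx), hV' x (hcl x hx)]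
  · intro x hx t ht
    linarith [hlatL x hx t (h01.trans ht.1), hhn t ht.1, hδv x (hfr x hx), hηt t ht]
  · intro x hx t ht
    rw [MHessian.blockTrace_smul hm, hv.equation x hx]
    have h1 := hpar (1 - δ) ⟨by linarith, by linarith⟩ _ (hTpos x hx).le (hv_m' x hx)
    have h2 : (1 - δ) ^ m * f x ≤ (1 - δ) * f x :=
      mul_le_mul_of_nonneg_right (pow_le_of_le_one (by linarith) (by linarith) (by omega))
        (hfpos x hx).le
    -- The barrier's `m`-trace is below `(1 - δ) f + (δ / 2) ν_m ≤ (1 - δ / 2) f ≤ E_m[u]`.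
    nlinarith [hEl x hx t ht, hf_lower x hx]
  · intro x hx
    linarith [(hC0 x hx).2, (hδv x (hcl x hx)).2, (hV' x (hcl x hx)).1]
  · intro x hx t ht
    linarith [hlatU x hx t (h01.trans ht.1), hh₁ t ht.1, (hδv x (hfr x hx)).2, hηt t ht]
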